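/- Let $q$ be a power of an odd prime, let $G=\mathrm{PGL}(2,q)$, and let $\overline{\mathbb{F}_q}$ be an algebraic closure of $\mathbb{F}_q$. The group $G$ acts on $\mathbb{P}^1(\overline{\mathbb{F}_q})=\overline{\mathbb{F}_q}\cup\{\infty\}$ by $s(z)=\frac{az+b}{cz+d}$, and $\mathbb{F}_q(x)^G$ denotes the field of those $r\in\mathbb{F}_q(x)$ with $r\left(\frac{ax+b}{cx+d}\right)=r(x)$ for all invertible $\begin{pmatrix}a&b\\c&d\end{pmatrix}$ over $\mathbb{F}_q$. Let $\Phi=f/g$ with $f,g\in\mathbb{F}_q[x]$, $\deg f=|G|$ and $\deg g<|G|$, be a generator of this field, i.e. $\mathbb{F}_q(\Phi)=\mathbb{F}_q(x)^G$. For $\alpha\in\overline{\mathbb{F}_q}$ let $\Phi(\alpha)\in\mathbb{P}^1(\overline{\mathbb{F}_q})$ be the value of $\Phi$ at $\alpha$. Then every $\lambda\in\mathbb{F}_q$ equals $\Phi(\alpha)$ for some $\alpha\in\overline{\mathbb{F}_q}$, and there is $\mu\in\mathbb{F}_q$ such that, for $\alpha\in\overline{\mathbb{F}_q}$, $\Phi(\alpha)=\mu$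 if and only if $\alpha\in\mathbb{F}_{q^2}\setminus\mathbb{F}_q$. There is a bijection $C$ from the $q$ points of $\mathbb{P}^1(\mathbb{F}_q)\setminus\{\mu\}$ onto the set of all conjugacy classes of $G$ that do not consist of elements of order $2$ (there are exactly $q$ of these), with the following properties. The class $C(\infty)$ is the identity class. If $\lambda\in\mathbb{F}_q$, $\lambda\neq\mu$, and $\alpha\in\overline{\mathbb{F}_q}$ satisfies $\Phi(\alpha)=\lambda$, then there is $s\in G$ with $s(\alpha)=\alpha^q$, and every such $s$ lies in $C(\lambda)$. If $\alpha\in\mathbb{F}_{q^2}\setminus\mathbb{F}_q$, then every $s\in G$ with $s(\alpha)=\alpha^q$ is an involution, but its conjugacy class is not uniquely determined: there are exactly two conjugacy classes of involutions in $G$, and each of them contains some $s$ with $s(\alpha)=\alpha^q$. Consequently $G$ has exactly $q+2$ conjugacy classes. -/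

import Mathlib

open scoped MatrixGroups Polynomial OnePoint

namespace PGLConj

section

variable (F K : Type*) [Field F] [Field K] [Algebra F K]

open Classical in
/-- The action of `PGL(2, F)` on the projective line `K ∪ {∞}` over an extension field `K` of `F`
by Möbius transformations, obtained from Mathlib's action of `GL (Fin 2) K` on `OnePoint K`. -/
noncomputable abbrev moebiusAction : MulAction PGL(2, F) (OnePoint K) :=
  letI : MulAction (GL (Fin 2) F) (OnePoint K) :=
    MulAction.compHom (OnePoint K) (Matrix.GeneralLinearGroup.map (n := Fin 2) (algebraMap F K))
  Matrix.ProjGenLinGroup.mulActionOfGL (n := Fin 2) (R := F) (α := OnePoint K) (by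
    intro u z
    change (Matrix.GeneralLinearGroup.map (n := Fin 2) (algebraMap F K)
      (Matrix.GeneralLinearGroup.scalar (Fin 2) u)) • z = z
    have hu : algebraMap F K (u : F) ≠ 0 := by simp
    cases z with
    | infty => simp [OnePoint.smul_infty_eq_ite]
    | coe k => simp [OnePoint.smul_some_eq_ite, hu])

variable {F K}

/-- The image `s(z)` of a point `z` of the projective line over `K` under `s ∈ PGL(2, F)`. -/
noncomputable def act (s : PGL(2, F)) (z : OnePoint K) : OnePoint K :=
  (moebiusAction F K).smul s z

open Classical in
/-- `act` is given by the usual formula `s(α) = (aα + b) / (cα + d)`. -/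
theorem act_mk_coe (A : GL (Fin 2) F) (α : K) :
    act (Matrix.ProjGenLinGroup.mk A) (α : OnePoint K) =
      if algebraMap F K (A 1 0) * α + algebraMap F K (A 1 1) = 0 then ∞
      else (((algebraMap F K (A 0 0) * α + algebraMap F K (A 0 1)) /
        (algebraMap F K (A 1 0) * α + algebraMap F K (A 1 1)) : K) : OnePoint K) := by
  change (Matrix.GeneralLinearGroup.map (n := Fin 2) (algebraMap F K) A) • (α : OnePoint K) = _
  rw [OnePoint.smul_some_eq_ite]
  simp

end

section

variable {F : Type*} [Field F]

/-- The rational function `(aX + b) / (cX + d)` attached to the invertible matrix `!![a, b; c, d]`. -/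
noncomputable def linearFractional (A : GL (Fin 2) F) : RatFunc F :=
  (RatFunc.C (A 0 0) * RatFunc.X + RatFunc.C (A 0 1)) /
    (RatFunc.C (A 1 0) * RatFunc.X + RatFunc.C (A 1 1))

/-- The composite `r((aX + b) / (cX + d))`. -/
noncomputable def compLinearFractional (r : RatFunc F) (A : GL (Fin 2) F) : RatFunc F :=
  r.eval (algebraMap F (RatFunc F)) (linearFractional A)

variable (F) in
/-- The rational functions over `F` that are invariant under `PGL(2, F)`. -/
def invariantFunctions : Set (RatFunc F) :=
  {r | ∀ A : GL (Fin 2) F, compLinearFractional r A = r}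

/-- `Φ` generates the field of `PGL(2, F)`-invariant rational functions over `F`. -/
def IsInvariantGenerator (Φ : RatFunc F) : Prop :=
  (IntermediateField.adjoin F {Φ} : Set (RatFunc F)) = invariantFunctions F

variable {K : Type*} [Field K] [Algebra F K]

open Classical in
/-- The value `Φ(α)`, a point of the projective line over `K`, of a rational function `Φ` over `F`
at `α ∈ K`; it is `∞` exactly when the reduced denominator of `Φ` vanishes at `α`. -/
noncomputable def value (Φ : RatFunc F) (α : K) : OnePoint K :=
  if Polynomial.aeval α Φ.denom = 0 then ∞
  else ((Polynomial.aeval α Φ.num / Polynomial.aeval α Φ.denom : K) : OnePoint K)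

/-- The conjugacy classes of those `s ∈ PGL(2, F)` with `s(α) = α ^ q`, where `q = |F|`. -/
def frobeniusClasses (F : Type*) [Field F] {K : Type*} [Field K] [Algebra F K] (α : K) :
    Set (ConjClasses PGL(2, F)) :=
  ConjClasses.mk '' {s | act s (α : OnePoint K) = ((α ^ Nat.card F : K) : OnePoint K)}

/-- The conjugacy classes of involutions of `PGL(2, F)`. -/
def involutionClasses (F : Type*) [Field F] : Set (ConjClasses PGL(2, F)) :=
  ConjClasses.mk '' {s | orderOf s = 2}

/-- `F_{q²} ∖ F_q` inside an algebraically closed extension `K` of `F`, where `q = |F|`. -/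
def quadraticElements (F K : Type*) [Field F] [Field K] [Algebra F K] : Set K :=
  {α | α ^ (Nat.card F ^ 2) = α ∧ α ∉ Set.range (algebraMap F K)}

end

end PGLConj

/-! ### Conjugacy in PGL(2, F) through trace and determinant. -/

namespace PGLConj

section

open Matrix Matrix.ProjGenLinGroup

variable {F : Type*} [Field F]

/-! A non-scalar 2×2 matrix is conjugate to its companion matrix, so a non-trivial class of PGL(2,
F) is the pair (tr, det) up to (u tr, u² det) (`isConj_mk_iff`). Trace zero means involution, and
there the square class of det gives two classes. Every other non-trivial class is determined by
tr²/det, which can be any non-zero element of F.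

The same number appears as a value of an invariant function. Put U = x^q - x, V = (x^(q²) - x)/U and
r = V^(q+1)/U^(q²-q), which is `invFunction`. For α outside F, r(α) is a cross ratio of α, α^q,
α^(q²), α^(q³). If s(α) = α^q, then s commutes with Frobenius, so these are α, s(α), s²(α), s³(α),
and the cross ratio is tr(s)²/det(s) (`aeval_invNum_mul_det`).

Conversely, if r(α) = t is a non-zero element of F, the |G| Möbius images of α exhaust the roots of
`invNum F - C t * invDenom F`. Frobenius preserves these roots, so α^q = s(α) for some s
(`exists_moebius_eq_frob`). The value 0 is taken exactly on F_{q²} ∖ F_q. There s has trace zero,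
and representing field elements by a binary quadratic form yields both square classes of det
(`frobeniusClasses_eq_involutionClasses`).

Finally Φ = a + b r with b ≠ 0 (`exists_eq_affine_invFunction`), so μ = a, and a point c ≠ a of F
goes to the class with tr²/det = (c - a)/b. -/

theorem mk_eq_mk_iff_smul {A B : GL (Fin 2) F} :
    mk A = mk B ↔ ∃ u : F, u ≠ 0 ∧ B.1 = u • A.1 := by
  rw [mk_eq_mk_iff]
  constructor
  · rintro ⟨u, rfl⟩
    refine ⟨u, u.ne_zero, ?_⟩
    ext i j
    fin_cases i <;> fin_cases j <;> simp [Matrix.mul_apply, Fin.sum_univ_two, mul_comm]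
  · rintro ⟨u, hu, h⟩
    refine ⟨Units.mk0 u hu, Units.ext ?_⟩
    rw [h]
    ext i j
    fin_cases i <;> fin_cases j <;> simp [Matrix.mul_apply, Fin.sum_univ_two, mul_comm]

theorem mk_eq_one_iff {A : GL (Fin 2) F} :
    mk A = 1 ↔ A 1 0 = 0 ∧ A 0 1 = 0 ∧ A 0 0 = A 1 1 := by
  rw [← mk_one, eq_comm, mk_eq_mk_iff_smul]
  constructor
  · rintro ⟨u, -, h⟩
    simp [h]
  · rintro ⟨h1, h2, h3⟩
    refine ⟨A 0 0, fun h => ?_, ?_⟩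
    · have := A.det_ne_zero
      rw [Matrix.det_fin_two] at this
      simp_all
    · ext i j
      fin_cases i <;> fin_cases j <;> simp [h1, h2, h3]

/-- The companion matrix of `X ^ 2 - t * X + d`. -/
def companion (t d : F) (hd : d ≠ 0) : GL (Fin 2) F :=
  Matrix.GeneralLinearGroup.mkOfDetNeZero !![0, -d; 1, t] (by simpa [Matrix.det_fin_two])

theorem coe_companion (t d : F) (hd : d ≠ 0) : (companion t d hd).1 = !![0, -d; 1, t] := rfl

theorem trace_companion (t d : F) (hd : d ≠ 0) : (companion t d hd).1.trace = t := by
  simp [coe_companion, Matrix.trace_fin_two]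

theorem det_companion (t d : F) (hd : d ≠ 0) : (companion t d hd).1.det = d := by
  simp [coe_companion, Matrix.det_fin_two]

theorem mk_companion_ne_one (t d : F) (hd : d ≠ 0) : mk (companion t d hd) ≠ 1 := by
  rw [Ne, mk_eq_one_iff]
  simp [coe_companion]

theorem isConj_of_mul_eq {A B : GL (Fin 2) F} (M : Matrix (Fin 2) (Fin 2) F) (hM : M.det ≠ 0)
    (h : A.1 * M = M * B.1) : IsConj A B := by
  rw [isConj_comm, isConj_iff]
  refine ⟨Matrix.GeneralLinearGroup.mkOfDetNeZero M hM, ?_⟩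
  rw [mul_inv_eq_iff_eq_mul]
  exact Units.ext h.symm

/-- A non-scalar invertible matrix is conjugate to a companion matrix. -/
theorem isConj_companion {A : GL (Fin 2) F} (hA : mk A ≠ 1) :
    IsConj A (companion A.1.trace A.1.det A.det_ne_zero) := by
  rw [Ne, mk_eq_one_iff] at hA
  set a := A 0 0
  set b := A 0 1
  set c := A 1 0
  set d := A 1 1
  have hAe : A.1 = !![a, b; c, d] := Matrix.eta_fin_two _
  -- The hypothesis says that v = (x, y) is not an eigenvector. In the basis v, Av the matrix is the
  -- companion matrix, by Cayley–Hamilton.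
  have key : ∀ x y : F, x * (c * x + d * y) - (a * x + b * y) * y ≠ 0 →
      IsConj A (companion A.1.trace A.1.det A.det_ne_zero) := by
    intro x y h
    refine isConj_of_mul_eq !![x, a * x + b * y; y, c * x + d * y] ?_ ?_
    · simpa [Matrix.det_fin_two] using h
    · rw [coe_companion, hAe]
      simp only [Matrix.trace_fin_two, Matrix.det_fin_two, Matrix.mul_fin_two]
      ext i j
      fin_cases i <;> fin_cases j <;> simp <;> ring
  -- If (1, 0), (0, 1) and (1, 1) were all eigenvectors, A would be scalar.
  by_cases hc : c = 0
  · by_cases hb : b = 0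
    · refine key 1 1 fun h => hA ⟨hc, hb, ?_⟩
      rw [hc, hb] at h
      linear_combination -h
    · exact key 0 1 (by simpa using hb)
  · exact key 1 0 (by simpa using hc)

theorem isConj_mk_of_isConj {A B : GL (Fin 2) F} (h : IsConj A B) : IsConj (mk A) (mk B) :=
  mk.map_isConj h

theorem exists_trace_det_of_isConj_mk {A B : GL (Fin 2) F} (h : IsConj (mk A) (mk B)) :
    ∃ u : F, u ≠ 0 ∧ B.1.trace = u * A.1.trace ∧ B.1.det = u ^ 2 * A.1.det := by
  obtain ⟨c, hc⟩ := isConj_iff.1 h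
  obtain ⟨P, rfl⟩ := mk_surjective c
  rw [← map_inv, ← map_mul, ← map_mul, mk_eq_mk_iff_smul] at hc
  obtain ⟨u, hu, h⟩ := hc
  refine ⟨u, hu, ?_, ?_⟩
  · rw [h, Matrix.trace_smul, smul_eq_mul, Units.val_mul, Units.val_mul, Matrix.trace_mul_cycle,
      ← Units.val_mul, inv_mul_cancel, Units.val_one, one_mul]
  · rw [h, Matrix.det_smul, Units.val_mul, Units.val_mul, Matrix.det_mul_right_comm,
      ← Units.val_mul, mul_inv_cancel, Units.val_one, one_mul, Fintype.card_fin]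

/-- Two non-trivial elements of `PGL(2, F)` are conjugate as soon as the traces and determinants of
representatives agree up to scaling. -/
theorem isConj_mk_iff {A B : GL (Fin 2) F} (hA : mk A ≠ 1) (hB : mk B ≠ 1) :
    IsConj (mk A) (mk B) ↔
      ∃ u : F, u ≠ 0 ∧ B.1.trace = u * A.1.trace ∧ B.1.det = u ^ 2 * A.1.det := by
  refine ⟨exists_trace_det_of_isConj_mk, ?_⟩
  rintro ⟨u, hu, ht, hd⟩
  let A' : GL (Fin 2) F := GeneralLinearGroup.mkOfDetNeZero (u • A.1) (by
    rw [Matrix.det_smul]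
    exact mul_ne_zero (pow_ne_zero _ hu) A.det_ne_zero)
  have hA' : A'.1 = u • A.1 := rfl
  have h1 : mk A = mk A' := mk_eq_mk_iff_smul.2 ⟨u, hu, hA'⟩
  have h2 := isConj_companion (A := A') (h1 ▸ hA)
  have h3 := isConj_companion hB
  have ht' : A'.1.trace = B.1.trace := by rw [hA', ht, Matrix.trace_smul, smul_eq_mul]
  have hd' : A'.1.det = B.1.det := by rw [hA', hd, Matrix.det_smul, Fintype.card_fin]
  rw [h1]
  simp only [ht', hd'] at h2
  exact isConj_mk_of_isConj (h2.trans h3.symm)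

/-- By Cayley–Hamilton A² = tr(A) A - det(A), so for non-scalar A the square is scalar exactly when
the trace vanishes. -/
theorem orderOf_mk_eq_two_iff {A : GL (Fin 2) F} :
    orderOf (mk A) = 2 ↔ mk A ≠ 1 ∧ A.1.trace = 0 := by
  rw [orderOf_eq_prime_iff, and_comm, and_congr_right_iff]
  intro hA
  rw [← map_pow, mk_eq_one_iff]
  rw [Ne, mk_eq_one_iff] at hA
  simp only [pow_two, Units.val_mul, Matrix.mul_apply, Fin.sum_univ_two, Matrix.trace_fin_two]
  constructor
  · rintro ⟨h1, h2, h3⟩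
    by_contra h
    refine hA ⟨?_, ?_, ?_⟩
    · exact (mul_eq_zero.1 (show A 1 0 * (A 0 0 + A 1 1) = 0 by linear_combination h1)).resolve_right h
    · exact (mul_eq_zero.1 (show A 0 1 * (A 0 0 + A 1 1) = 0 by linear_combination h2)).resolve_right h
    · exact sub_eq_zero.1 ((mul_eq_zero.1 (show (A 0 0 - A 1 1) * (A 0 0 + A 1 1) = 0 by
        linear_combination h3)).resolve_right h)
  · intro h
    refine ⟨?_, ?_, ?_⟩
    · linear_combination A 1 0 * h
    · linear_combination A 0 1 * h
    · linear_combination (A 0 0 - A 1 1) * h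

theorem mk_mem_involutionClasses_iff {s : PGL(2, F)} :
    ConjClasses.mk s ∈ involutionClasses F ↔ orderOf s = 2 := by
  constructor
  · rintro ⟨t, ht, h⟩
    obtain ⟨c, hc⟩ := isConj_iff.1 (ConjClasses.mk_eq_mk_iff_isConj.1 h)
    rw [← hc]
    have : c * t * c⁻¹ = MulAut.conj c t := rfl
    rw [this, MulEquiv.orderOf_eq]
    exact ht
  · exact fun h => ⟨s, h, rfl⟩

/-- For odd `|F|` there are exactly two classes of involutions, told apart by the square class of
the determinant. -/
theorem ncard_involutionClasses [Finite F] (hF : ringChar F ≠ 2) :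
    (involutionClasses F).ncard = 2 := by
  obtain ⟨e, he⟩ := FiniteField.exists_nonsquare hF
  have he0 : e ≠ 0 := fun h => he (h ▸ IsSquare.zero)
  have hmem : ∀ d : F, ∀ hd : d ≠ 0,
      ConjClasses.mk (mk (companion 0 d hd)) ∈ involutionClasses F := fun d hd =>
    ⟨_, orderOf_mk_eq_two_iff.2 ⟨mk_companion_ne_one _ _ _, trace_companion _ _ _⟩, rfl⟩
  rw [Set.ncard_eq_two]
  refine ⟨ConjClasses.mk (mk (companion 0 1 one_ne_zero)),
    ConjClasses.mk (mk (companion 0 e he0)), ?_, ?_⟩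
  · intro h
    rw [ConjClasses.mk_eq_mk_iff_isConj] at h
    obtain ⟨u, hu, -, h⟩ := exists_trace_det_of_isConj_mk h
    rw [det_companion, det_companion] at h
    exact he ⟨u, by rw [h]; ring⟩
  · refine Set.Subset.antisymm ?_ (Set.insert_subset (hmem _ _)
      (Set.singleton_subset_iff.2 (hmem _ _)))
    rintro _ ⟨s, hs, rfl⟩
    obtain ⟨A, rfl⟩ := mk_surjective s
    obtain ⟨h1, ht⟩ := orderOf_mk_eq_two_iff.1 hs
    have hd := A.det_ne_zero
    simp only [Set.mem_insert_iff, Set.mem_singleton_iff, ConjClasses.mk_eq_mk_iff_isConj]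
    by_cases h : IsSquare A.1.det
    · left
      obtain ⟨u, hu⟩ := h
      have hu0 : u ≠ 0 := by rintro rfl; exact hd (by simpa using hu)
      rw [isConj_mk_iff h1 (mk_companion_ne_one _ _ _)]
      refine ⟨u⁻¹, inv_ne_zero hu0, ?_, ?_⟩
      · rw [trace_companion, ht, mul_zero]
      · rw [det_companion, hu]
        field_simp
    · right
      -- Over a finite field of odd order the product of two non-squares is a square.
      have : IsSquare (e * A.1.det) := by
        classical
        have := Fintype.ofFinite F
        rw [← quadraticChar_one_iff_isSquare (mul_ne_zero he0 hd), map_mul,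
          quadraticChar_neg_one_iff_not_isSquare.2 h, quadraticChar_neg_one_iff_not_isSquare.2 he]
        norm_num
      obtain ⟨u, hu⟩ := this
      rw [isConj_mk_iff h1 (mk_companion_ne_one _ _ _)]
      have hu0 : u ≠ 0 := by
        rintro rfl
        exact mul_ne_zero he0 hd (by simpa using hu)
      refine ⟨u / A.1.det, div_ne_zero hu0 hd, ?_, ?_⟩
      · rw [trace_companion, ht, mul_zero]
      · rw [det_companion]
        field_simp
        linear_combination hu

end

end PGLConj

/-! ### Generic points, their regular orbits, and Frobenius. -/

namespace PGLConj

section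

open Matrix Matrix.ProjGenLinGroup

variable {F : Type*} [Field F] {L : Type*} [Field L] [Algebra F L]

/-- `α` satisfies no non-trivial quadratic equation over `F`. -/
def IsGeneric (F : Type*) [Field F] {L : Type*} [Field L] [Algebra F L] (α : L) : Prop :=
  ∀ a b c : F, algebraMap F L a * α ^ 2 + algebraMap F L b * α + algebraMap F L c = 0 →
    a = 0 ∧ b = 0 ∧ c = 0

/-- The fractional linear transform `(aα + b) / (cα + d)`. -/
def moebius (A : GL (Fin 2) F) (α : L) : L :=
  (algebraMap F L (A 0 0) * α + algebraMap F L (A 0 1)) /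
    (algebraMap F L (A 1 0) * α + algebraMap F L (A 1 1))

theorem det_entries_ne_zero (A : GL (Fin 2) F) : A 0 0 * A 1 1 - A 0 1 * A 1 0 ≠ 0 := by
  rw [← Matrix.det_fin_two]
  exact A.det_ne_zero

theorem bottom_ne_zero (A : GL (Fin 2) F) {α : L} (hα : α ∉ Set.range (algebraMap F L)) :
    algebraMap F L (A 1 0) * α + algebraMap F L (A 1 1) ≠ 0 := by
  intro h
  by_cases hc : A 1 0 = 0
  · refine det_entries_ne_zero A ?_
    rw [hc, map_zero, zero_mul, zero_add, FaithfulSMul.algebraMap_eq_zero_iff] at h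
    rw [h, hc]
    ring
  · refine hα ⟨-(A 1 1) / A 1 0, ?_⟩
    rw [map_div₀, map_neg, div_eq_iff (by simpa using hc)]
    linear_combination -h

/-- This transformation rule for differences drives the invariance proof. -/
theorem moebius_sub_moebius (A : GL (Fin 2) F) {x y : L}
    (hx : algebraMap F L (A 1 0) * x + algebraMap F L (A 1 1) ≠ 0)
    (hy : algebraMap F L (A 1 0) * y + algebraMap F L (A 1 1) ≠ 0) :
    (moebius A y - moebius A x) * ((algebraMap F L (A 1 0) * x + algebraMap F L (A 1 1)) *
      (algebraMap F L (A 1 0) * y + algebraMap F L (A 1 1))) =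
      algebraMap F L (A 0 0 * A 1 1 - A 0 1 * A 1 0) * (y - x) := by
  rw [moebius, moebius, div_sub_div _ _ hy hx, div_mul_eq_mul_div,
    div_eq_iff (mul_ne_zero hy hx)]
  simp only [map_sub, map_mul]
  ring

theorem IsGeneric.notMem_range {α : L} (hα : IsGeneric F α) :
    α ∉ Set.range (algebraMap F L) := by
  rintro ⟨x, rfl⟩
  have := hα 0 1 (-x) (by simp)
  simp at this

theorem act_mk_eq_coe_iff (A : GL (Fin 2) F) {α : L} (hα : α ∉ Set.range (algebraMap F L))
    (β : L) : act (mk A) (α : OnePoint L) = (β : OnePoint L) ↔ moebius A α = β := by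
  rw [act_mk_coe, if_neg (bottom_ne_zero A hα), OnePoint.coe_eq_coe]
  rfl

/-- Clearing denominators gives a quadratic relation for α over F, so its coefficients vanish. Up to
the factor ±1/det B they are the entries of B⁻¹A that must vanish for it to be scalar. -/
theorem mk_eq_mk_of_moebius_eq {α : L} (hα : IsGeneric F α) {A B : GL (Fin 2) F}
    (h : moebius A α = moebius B α) : mk A = mk B := by
  rw [moebius, moebius, div_eq_div_iff (bottom_ne_zero A hα.notMem_range)
    (bottom_ne_zero B hα.notMem_range)] at h
  obtain ⟨h1, h2, h3⟩ := hα (A 0 0 * B 1 0 - B 0 0 * A 1 0)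
    (A 0 0 * B 1 1 + A 0 1 * B 1 0 - B 0 0 * A 1 1 - B 0 1 * A 1 0)
    (A 0 1 * B 1 1 - B 0 1 * A 1 1) (by
      simp only [map_sub, map_add, map_mul]
      linear_combination h)
  rw [eq_comm, ← inv_mul_eq_one, ← map_inv, ← map_mul, mk_eq_one_iff]
  have hB : (B⁻¹ * A).1 = B.1⁻¹ * A.1 := by simp
  have hentry : ∀ i j, (B⁻¹ * A) i j = (B.1⁻¹ * A.1) i j := fun i j => by rw [← hB]
  simp only [hentry, Matrix.inv_def, Matrix.adjugate_fin_two, Matrix.mul_apply, Fin.sum_univ_two,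
    Matrix.smul_apply, smul_eq_mul, Matrix.of_apply, Matrix.cons_val', Matrix.cons_val_zero,
    Matrix.cons_val_one, Matrix.cons_val_fin_one]
  refine ⟨?_, ?_, ?_⟩
  · linear_combination -(Ring.inverse B.1.det) * h1
  · linear_combination (Ring.inverse B.1.det) * h3
  · linear_combination (Ring.inverse B.1.det) * h2

theorem isGeneric_X : IsGeneric F (RatFunc.X : RatFunc F) := by
  intro a b c h
  have h' : algebraMap F[X] (RatFunc F) (Polynomial.C a * Polynomial.X ^ 2 +
      Polynomial.C b * Polynomial.X + Polynomial.C c) = 0 := by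
    simpa [RatFunc.algebraMap_eq_C] using h
  rw [FaithfulSMul.algebraMap_eq_zero_iff] at h'
  refine ⟨?_, ?_, ?_⟩
  · simpa [Polynomial.coeff_X, Polynomial.coeff_C] using congrArg (fun p => Polynomial.coeff p 2) h'
  · simpa [Polynomial.coeff_X, Polynomial.coeff_C] using congrArg (fun p => Polynomial.coeff p 1) h'
  · simpa [Polynomial.coeff_X, Polynomial.coeff_C] using congrArg (fun p => Polynomial.coeff p 0) h'

variable [Finite F]

instance : Finite PGL(2, F) := Finite.of_surjective _ mk_surjective

theorem exists_orbit_finset {α : L} (hα : IsGeneric F α) :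
    ∃ S : Finset L, S.card = Nat.card PGL(2, F) ∧ ∀ β ∈ S, ∃ A : GL (Fin 2) F, β = moebius A α := by
  classical
  have := Fintype.ofFinite PGL(2, F)
  refine ⟨Finset.univ.image fun s : PGL(2, F) =>
    moebius (Function.surjInv mk_surjective s) α, ?_, ?_⟩
  · rw [Finset.card_image_of_injective, Finset.card_univ, Nat.card_eq_fintype_card]
    intro s t h
    simpa [Function.surjInv_eq] using mk_eq_mk_of_moebius_eq hα h
  · intro β hβ
    obtain ⟨s, -, rfl⟩ := Finset.mem_image.1 hβ
    exact ⟨_, rfl⟩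

theorem eq_zero_of_eval_moebius {α : L} (hα : IsGeneric F α) {p : L[X]}
    (hp : p.natDegree < Nat.card PGL(2, F)) (h : ∀ A : GL (Fin 2) F, p.eval (moebius A α) = 0) :
    p = 0 := by
  obtain ⟨S, hS, hS'⟩ := exists_orbit_finset hα
  refine Polynomial.eq_zero_of_natDegree_lt_card_of_eval_eq_zero' p S ?_ (hS ▸ hp)
  intro β hβ
  obtain ⟨A, rfl⟩ := hS' β hβ
  exact h A

/-- The orbit of a generic point already supplies |G| roots, leaving no room for another. -/
theorem exists_moebius_of_eval_eq_zero {α : L} (hα : IsGeneric F α) {p : L[X]} (hp0 : p ≠ 0)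
    (hp : p.natDegree ≤ Nat.card PGL(2, F)) (h : ∀ A : GL (Fin 2) F, p.eval (moebius A α) = 0)
    {β : L} (hβ : p.eval β = 0) : ∃ A : GL (Fin 2) F, β = moebius A α := by
  classical
  obtain ⟨S, hS, hS'⟩ := exists_orbit_finset hα
  by_cases hβS : β ∈ S
  · exact hS' β hβS
  · refine absurd (Polynomial.eq_zero_of_natDegree_lt_card_of_eval_eq_zero' p (insert β S) ?_ ?_) hp0
    · intro γ hγ
      rcases Finset.mem_insert.1 hγ with rfl | hγ
      · exact hβ
      · obtain ⟨A, rfl⟩ := hS' γ hγ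
        exact h A
    · rw [Finset.card_insert_of_notMem hβS, hS]
      omega

theorem card_PGL_two : Nat.card PGL(2, F) = Nat.card F ^ 3 - Nat.card F := by
  have := Fintype.ofFinite F
  have h1 := Matrix.card_GL_field (𝔽 := F) 2
  have h2 := Subgroup.card_eq_card_quotient_mul_card_subgroup (Subgroup.center (GL (Fin 2) F))
  have h3 : Nat.card (Subgroup.center (GL (Fin 2) F)) = Nat.card F - 1 := by
    rw [GeneralLinearGroup.center_eq_range_scalar, ← Nat.card_units]
    refine (Nat.card_congr (MonoidHom.ofInjective (f := GeneralLinearGroup.scalar (Fin 2))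
      fun u v h => ?_).toEquiv).symm
    have := congrArg (fun M : GL (Fin 2) F => M 0 0) h
    exact Units.ext (by simpa using this)
  rw [h1, h3, Fin.prod_univ_two] at h2
  change _ = Nat.card PGL(2, F) * _ at h2
  have hc : Nat.card F = Fintype.card F := Nat.card_eq_fintype_card
  rw [hc] at h2 ⊢
  have hq : 2 ≤ Fintype.card F := Fintype.one_lt_card
  -- Writing q = 2 + n removes the truncated subtractions.
  obtain ⟨n, hn⟩ := Nat.exists_eq_add_of_le hq
  rw [hn] at h2 ⊢
  refine Nat.eq_of_mul_eq_mul_right (show 0 < 2 + n - 1 by omega) (h2.symm.trans ?_)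
  have e1 : (2 + n) ^ 2 - (2 + n) ^ ((0 : Fin 2) : ℕ) = (n + 1) * (n + 3) := by
    rw [Nat.sub_eq_iff_eq_add (Nat.pow_le_pow_right (by omega) (by simp))]
    simp
    ring
  have e2 : (2 + n) ^ 2 - (2 + n) ^ ((1 : Fin 2) : ℕ) = (n + 2) * (n + 1) := by
    rw [Nat.sub_eq_iff_eq_add (Nat.pow_le_pow_right (by omega) (by simp))]
    simp
    ring
  have e3 : (2 + n) ^ 3 - (2 + n) = (n + 1) * (n + 2) * (n + 3) := by
    rw [Nat.sub_eq_iff_eq_add (Nat.le_self_pow (by omega) _)]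
    ring
  have e4 : 2 + n - 1 = n + 1 := by omega
  rw [e1, e2, e3, e4]
  ring

/-- The `q`-power Frobenius endomorphism of an extension of a field with `q` elements. -/
noncomputable def frob (F L : Type*) [Field F] [Finite F] [Field L] [Algebra F L] : L →ₐ[F] L :=
  letI := Fintype.ofFinite F
  FiniteField.frobeniusAlgHom F L

theorem frob_apply (x : L) : frob F L x = x ^ Nat.card F := by
  let := Fintype.ofFinite F
  rw [Nat.card_eq_fintype_card]
  rfl

theorem frob_frob (x : L) : frob F L (frob F L x) = x ^ (Nat.card F ^ 2) := by
  rw [frob_apply, frob_apply, ← pow_mul, pow_two]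

theorem mem_range_iff_frob {x : L} : x ∈ Set.range (algebraMap F L) ↔ frob F L x = x := by
  classical
  constructor
  · rintro ⟨y, rfl⟩
    exact AlgHom.commutes _ _
  · intro h
    by_contra hx
    have := Fintype.ofFinite F
    have hq : 1 < Nat.card F := Finite.one_lt_card
    have hp : (Polynomial.X ^ Nat.card F - Polynomial.X : L[X]).natDegree = Nat.card F :=
      FiniteField.X_pow_card_sub_X_natDegree_eq L hq
    refine FiniteField.X_pow_card_sub_X_ne_zero L hq
      (Polynomial.eq_zero_of_natDegree_lt_card_of_eval_eq_zero' _
        (insert x (Finset.univ.image (algebraMap F L))) ?_ ?_)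
    · have key : ∀ y : L, frob F L y = y →
          (Polynomial.X ^ Nat.card F - Polynomial.X : L[X]).eval y = 0 := fun y hy => by
        rw [Polynomial.eval_sub, Polynomial.eval_pow, Polynomial.eval_X, ← frob_apply, hy, sub_self]
      intro y hy
      rcases Finset.mem_insert.1 hy with rfl | hy
      · exact key _ h
      · obtain ⟨z, -, rfl⟩ := Finset.mem_image.1 hy
        exact key _ (AlgHom.commutes _ _)
    · rw [hp, Finset.card_insert_of_notMem (by simpa using hx),
        Finset.card_image_of_injective _ (algebraMap F L).injective, Finset.card_univ,
        Nat.card_eq_fintype_card]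
      omega

/-- Frobenius carries a quadratic relation for α to α^q and α^(q²). Two successive divided
differences then kill the leading coefficient, and the others follow. -/
theorem isGeneric_of_frob_frob_ne {α : L} (h : frob F L (frob F L α) ≠ α) : IsGeneric F α := by
  have hα : α ∉ Set.range (algebraMap F L) := fun h' => h <| by
    rw [mem_range_iff_frob] at h'
    rw [h', h']
  intro a b c habc
  have h1 := congrArg (frob F L) habc
  have h2 := congrArg (frob F L) h1
  simp only [map_add, map_mul, map_pow, AlgHom.commutes, map_zero] at h1 h2
  have hy := hα
  rw [mem_range_iff_frob] at hy
  set y := frob F L α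
  set z := frob F L y
  have hyz : z ≠ y := fun e => hy ((frob F L).injective e)
  have e1 : algebraMap F L a * (y + α) + algebraMap F L b = 0 := by
    refine (mul_eq_zero.1 ?_).resolve_left (sub_ne_zero.2 hy)
    linear_combination h1 - habc
  have e2 : algebraMap F L a * (z + y) + algebraMap F L b = 0 := by
    refine (mul_eq_zero.1 ?_).resolve_left (sub_ne_zero.2 hyz)
    linear_combination h2 - h1
  have ha : algebraMap F L a = 0 := by
    refine (mul_eq_zero.1 ?_).resolve_right (sub_ne_zero.2 h)
    linear_combination e2 - e1
  have hb : algebraMap F L b = 0 := by simpa [ha] using e1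
  have hc : algebraMap F L c = 0 := by simpa [ha, hb] using habc
  simpa using And.intro ha (And.intro hb hc)

end

end PGLConj

/-! ### The standard invariant function and its values. -/

namespace PGLConj

section

open Matrix Matrix.ProjGenLinGroup

section Polynomials

variable (F : Type*) [Field F]

/-- The polynomial `X ^ q - X`. -/
noncomputable def frobSub : F[X] := Polynomial.X ^ Nat.card F - Polynomial.X

/-- The polynomial `(X ^ q ^ 2 - X) / (X ^ q - X)`, whose roots are the elements of degree two. -/
noncomputable def quadraticPoly : F[X] := frobSub F ^ (Nat.card F - 1) + 1

/-- The numerator of the standard `PGL(2, q)`-invariant function. -/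
noncomputable def invNum : F[X] := quadraticPoly F ^ (Nat.card F + 1)

/-- The denominator of the standard `PGL(2, q)`-invariant function. -/
noncomputable def invDenom : F[X] := frobSub F ^ (Nat.card F ^ 2 - Nat.card F)

variable [Finite F]

theorem monic_frobSub : (frobSub F).Monic := by
  have := Fintype.ofFinite F
  refine Polynomial.monic_X_pow_sub ?_
  rw [Polynomial.degree_X]
  exact_mod_cast Finite.one_lt_card

theorem natDegree_frobSub : (frobSub F).natDegree = Nat.card F :=
  FiniteField.X_pow_card_sub_X_natDegree_eq F Finite.one_lt_card

theorem natDegree_frobSub_pow : (frobSub F ^ (Nat.card F - 1)).natDegree =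
    (Nat.card F - 1) * Nat.card F := by
  rw [(monic_frobSub F).natDegree_pow, natDegree_frobSub]

theorem monic_quadraticPoly : (quadraticPoly F).Monic := by
  have hq : 1 < Nat.card F := Finite.one_lt_card
  refine ((monic_frobSub F).pow _).add_of_left (Polynomial.degree_lt_degree ?_)
  rw [natDegree_frobSub_pow, Polynomial.natDegree_one]
  exact Nat.mul_pos (by omega) (by omega)

theorem natDegree_quadraticPoly : (quadraticPoly F).natDegree = (Nat.card F - 1) * Nat.card F := by
  rw [quadraticPoly, ← Polynomial.C_1, Polynomial.natDegree_add_C, natDegree_frobSub_pow]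

theorem monic_invNum : (invNum F).Monic := (monic_quadraticPoly F).pow _

theorem monic_invDenom : (invDenom F).Monic := (monic_frobSub F).pow _

theorem natDegree_invNum : (invNum F).natDegree = Nat.card PGL(2, F) := by
  rw [invNum, (monic_quadraticPoly F).natDegree_pow, natDegree_quadraticPoly, card_PGL_two]
  obtain ⟨n, hn⟩ := Nat.exists_eq_add_of_le (Nat.succ_le_of_lt (Finite.card_pos (α := F)))
  rw [hn, eq_comm, Nat.sub_eq_iff_eq_add (Nat.le_self_pow (by omega) _)]
  simp
  ring

theorem natDegree_invDenom_lt : (invDenom F).natDegree < Nat.card PGL(2, F) := by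
  have hq : 1 < Nat.card F := Finite.one_lt_card
  rw [invDenom, (monic_frobSub F).natDegree_pow, natDegree_frobSub, card_PGL_two, Nat.sub_mul]
  have h1 : Nat.card F < Nat.card F * Nat.card F := by nlinarith
  have h2 : Nat.card F * Nat.card F < Nat.card F ^ 3 := by nlinarith
  have h3 : Nat.card F ^ 2 * Nat.card F = Nat.card F ^ 3 := by ring
  omega

theorem isCoprime_invNum_invDenom : IsCoprime (invNum F) (invDenom F) := by
  have hq : 1 < Nat.card F := Finite.one_lt_card
  -- Bézout relation from V = U^(q-1) + 1, where U is `frobSub F` and V is `quadraticPoly F`.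
  refine IsCoprime.pow ⟨1, -frobSub F ^ (Nat.card F - 2), ?_⟩
  rw [quadraticPoly, show Nat.card F - 1 = Nat.card F - 2 + 1 by omega, pow_succ]
  ring

end Polynomials

variable {F : Type*} [Field F] [Finite F] {L : Type*} [Field L] [Algebra F L]

theorem aeval_frobSub (x : L) : Polynomial.aeval x (frobSub F) = frob F L x - x := by
  simp [frobSub, frob_apply]

theorem aeval_invNum (x : L) : Polynomial.aeval x (invNum F) =
    Polynomial.aeval x (quadraticPoly F) * frob F L (Polynomial.aeval x (quadraticPoly F)) := by
  rw [invNum, map_pow, frob_apply, pow_succ']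

theorem sub_mul_aeval_quadraticPoly (x : L) :
    (frob F L x - x) * Polynomial.aeval x (quadraticPoly F) = frob F L (frob F L x) - x := by
  have hq : 1 < Nat.card F := Finite.one_lt_card
  rw [quadraticPoly, map_add, map_pow, map_one, aeval_frobSub, mul_add, ← pow_succ',
    show Nat.card F - 1 + 1 = Nat.card F by omega, ← frob_apply, map_sub]
  ring

theorem aeval_invDenom_mul (x : L) :
    Polynomial.aeval x (invDenom F) * (frob F L (frob F L x) - frob F L x) =
      frob F L (frob F L (frob F L x)) - frob F L (frob F L x) := by
  rw [← map_sub, ← map_sub, ← map_sub, invDenom, map_pow, aeval_frobSub, frob_frob,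
    frob_apply (frob F L x - x), ← pow_add, Nat.sub_add_cancel (Nat.le_self_pow (by omega) _)]

theorem frob_sub_ne_zero {α : L} (hα : α ∉ Set.range (algebraMap F L)) : frob F L α - α ≠ 0 :=
  fun h => hα (mem_range_iff_frob.2 (sub_eq_zero.1 h))

theorem aeval_invDenom_eq_zero_iff {α : L} :
    Polynomial.aeval α (invDenom F) = 0 ↔ α ∈ Set.range (algebraMap F L) := by
  have hq : 1 < Nat.card F := Finite.one_lt_card
  have : Nat.card F < Nat.card F ^ 2 := by nlinarith
  rw [invDenom, map_pow, pow_eq_zero_iff (by omega), aeval_frobSub, mem_range_iff_frob, sub_eq_zero]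

theorem aeval_invNum_eq_zero_iff {α : L} :
    Polynomial.aeval α (invNum F) = 0 ↔
      frob F L (frob F L α) = α ∧ α ∉ Set.range (algebraMap F L) := by
  rw [invNum, map_pow, pow_eq_zero_iff (by omega)]
  have key := sub_mul_aeval_quadraticPoly (F := F) α
  constructor
  · intro h
    refine ⟨sub_eq_zero.1 (by rw [← key, h, mul_zero]), fun h' => ?_⟩
    have hq : 1 < Nat.card F := Finite.one_lt_card
    rw [quadraticPoly, map_add, map_pow, aeval_frobSub, mem_range_iff_frob.1 h', sub_self,
      zero_pow (by omega)] at h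
    simp at h
  · rintro ⟨h1, h2⟩
    rw [h1, sub_self] at key
    exact (mul_eq_zero.1 key).resolve_left (frob_sub_ne_zero h2)

theorem frob_moebius (A : GL (Fin 2) F) (α : L) : frob F L (moebius A α) = moebius A (frob F L α) := by
  simp [moebius]

/-- The standard invariant function is invariant. -/
theorem aeval_moebius_invNum_mul (A : GL (Fin 2) F) {α : L} (hα : α ∉ Set.range (algebraMap F L)) :
    Polynomial.aeval (moebius A α) (invNum F) * Polynomial.aeval α (invDenom F) =
      Polynomial.aeval α (invNum F) * Polynomial.aeval (moebius A α) (invDenom F) := by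
  have hq : 1 < Nat.card F := Finite.one_lt_card
  set δ : F := A 0 0 * A 1 1 - A 0 1 * A 1 0 with hδ
  have hδ0 : δ ≠ 0 := det_entries_ne_zero A
  have hδL : algebraMap F L δ ≠ 0 := by simpa using hδ0
  set J := algebraMap F L (A 1 0) * α + algebraMap F L (A 1 1) with hJ
  have hJ0 : J ≠ 0 := bottom_ne_zero A hα
  have hJ1 : algebraMap F L (A 1 0) * frob F L α + algebraMap F L (A 1 1) = frob F L J := by
    simp [hJ]
  have hJ2 : algebraMap F L (A 1 0) * frob F L (frob F L α) + algebraMap F L (A 1 1) =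
    frob F L (frob F L J) := by simp [hJ]
  have hJ10 : frob F L J ≠ 0 := by simpa using hJ0
  have hJ20 : frob F L (frob F L J) ≠ 0 := by simpa using hJ0
  have hU : (frob F L (moebius A α) - moebius A α) * (J * frob F L J) =
      algebraMap F L δ * (frob F L α - α) := by
    rw [frob_moebius, hJ, ← hJ1, moebius_sub_moebius A hJ0 (by rwa [hJ1])]
  have hU2 : (frob F L (frob F L (moebius A α)) - moebius A α) * (J * frob F L (frob F L J)) =
      algebraMap F L δ * (frob F L (frob F L α) - α) := by
    rw [frob_moebius, frob_moebius, hJ, ← hJ2, moebius_sub_moebius A hJ0 (by rwa [hJ2])]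
  have hα0 : frob F L α - α ≠ 0 := frob_sub_ne_zero hα
  -- V is the quotient of the differences in `hU2` and `hU`, so δ and one factor J cancel.
  have hV : Polynomial.aeval (moebius A α) (quadraticPoly F) * frob F L (frob F L J) =
      Polynomial.aeval α (quadraticPoly F) * frob F L J := by
    rw [← sub_mul_aeval_quadraticPoly, ← sub_mul_aeval_quadraticPoly] at hU2
    refine mul_left_cancel₀ (mul_ne_zero hδL hα0) ?_
    linear_combination frob F L J * hU2 - hU * (
      Polynomial.aeval (moebius A α) (quadraticPoly F) * frob F L (frob F L J))
  have hP : Polynomial.aeval (moebius A α) (invNum F) * frob F L (frob F L J) ^ (Nat.card F + 1) =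
      Polynomial.aeval α (invNum F) * frob F L J ^ (Nat.card F + 1) := by
    rw [invNum, map_pow, map_pow, ← mul_pow, ← mul_pow, hV]
  have hQ : Polynomial.aeval (moebius A α) (invDenom F) *
      (J * frob F L J) ^ (Nat.card F ^ 2 - Nat.card F) = Polynomial.aeval α (invDenom F) := by
    rw [invDenom, map_pow, map_pow, ← mul_pow, aeval_frobSub, aeval_frobSub, hU, mul_pow]
    -- δ lies in F, so δ^(q²) = δ^q = δ.
    have : algebraMap F L δ ^ (Nat.card F ^ 2 - Nat.card F) = 1 := by
      have h1 : algebraMap F L δ ^ (Nat.card F ^ 2 - Nat.card F) * algebraMap F L δ ^ Nat.card F =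
          algebraMap F L δ := by
        rw [← pow_add, Nat.sub_add_cancel (Nat.le_self_pow (by omega) _), ← frob_frob,
          AlgHom.commutes, AlgHom.commutes]
      rw [← frob_apply, AlgHom.commutes] at h1
      exact mul_right_cancel₀ hδL (by rw [h1, one_mul])
    rw [this, one_mul]
  -- The automorphy factors cancel because (q + 1)(q² - q) + q(q + 1) = q²(q + 1).
  have hJJ : (J * frob F L J) ^ (Nat.card F ^ 2 - Nat.card F) * frob F L J ^ (Nat.card F + 1) =
      frob F L (frob F L J) ^ (Nat.card F + 1) := by
    rw [frob_frob, frob_apply, ← pow_succ', ← pow_mul, ← pow_mul, ← pow_mul, ← pow_add]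
    congr 1
    have : Nat.card F ≤ Nat.card F ^ 2 := Nat.le_self_pow (by omega) _
    rw [Nat.mul_comm (Nat.card F), ← Nat.mul_add, Nat.sub_add_cancel this, Nat.mul_comm]
  refine mul_right_cancel₀ (pow_ne_zero (Nat.card F + 1) hJ20) ?_
  linear_combination Polynomial.aeval α (invDenom F) * hP -
    Polynomial.aeval α (invNum F) * frob F L J ^ (Nat.card F + 1) * hQ +
    Polynomial.aeval α (invNum F) * Polynomial.aeval (moebius A α) (invDenom F) * hJJ

/-- The cross ratio of four consecutive points `x, s(x), s²(x), s³(x)` is `tr(s) ^ 2 / det(s)`. -/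
theorem sub_mul_sub_mul_det_eq {R : Type*} [Field R] {a b c d x y z w : R}
    (hδ : a * d - b * c ≠ 0) (h1 : a * x + b = y * (c * x + d)) (h2 : a * y + b = z * (c * y + d))
    (h3 : a * z + b = w * (c * z + d)) :
    (z - x) * (w - y) * (a * d - b * c) = (a + d) ^ 2 * (y - x) * (w - z) := by
  -- With x = s⁻¹(y) = (dy - b)/(a - cy), the factor a - cy is det/(cx + d). In `g1` and `g2` the
  -- two-step differences become the trace times one-step differences.
  have f1 : (a - c * y) * (c * x + d) = a * d - b * c := by linear_combination c * h1
  have f2 : (a - c * z) * (c * y + d) = a * d - b * c := by linear_combination c * h2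
  have g1 : (z - x) * (a - c * y) = (a + d) * (z - y) := by linear_combination h2 - h1
  have g2 : (w - y) * (a - c * z) = (a + d) * (w - z) := by linear_combination h3 - h2
  have k : (z - y) * (c * x + d) * (c * y + d) = (a * d - b * c) * (y - x) := by
    linear_combination (c * y + d) * h1 - (c * x + d) * h2
  refine mul_left_cancel₀ hδ ?_
  linear_combination (z - x) * (w - y) * (-(a * d - b * c) * f1
    - (a - c * y) * (c * x + d) * f2) + (c * x + d) * (c * y + d) * (w - y) * (a - c * z) * g1 +
    (c * x + d) * (c * y + d) * (a + d) * (z - y) * g2 + (a + d) ^ 2 * (w - z) * k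

/-- If `s(α) = α ^ q`, then the standard invariant function takes at `α` the value
`tr(s) ^ 2 / det(s)`. -/
theorem aeval_invNum_mul_det {A : GL (Fin 2) F} {α : L} (hα : α ∉ Set.range (algebraMap F L))
    (h : moebius A α = frob F L α) :
    Polynomial.aeval α (invNum F) * algebraMap F L A.1.det =
      algebraMap F L A.1.trace ^ 2 * Polynomial.aeval α (invDenom F) := by
  have hU := frob_sub_ne_zero hα
  have hy : frob F L α ∉ Set.range (algebraMap F L) := fun h' => hα <| by
    rw [mem_range_iff_frob] at h' ⊢
    exact (frob F L).injective h'
  have hz : frob F L (frob F L α) ∉ Set.range (algebraMap F L) := fun h' => hy <| by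
    rw [mem_range_iff_frob] at h' ⊢
    exact (frob F L).injective h'
  have e1 := congrArg (frob F L) h
  have e2 := congrArg (frob F L) e1
  have hV := sub_mul_aeval_quadraticPoly (F := F) α
  have hV1 := congrArg (frob F L) hV
  have hQ := aeval_invDenom_mul (F := F) α
  rw [frob_moebius] at e1 e2
  rw [frob_moebius] at e2
  rw [map_mul, map_sub, map_sub] at hV1
  have hUy := frob_sub_ne_zero hy
  have d1 := bottom_ne_zero A hα
  have d2 := bottom_ne_zero A hy
  have d3 := bottom_ne_zero A hz
  rw [aeval_invNum, Matrix.det_fin_two, Matrix.trace_fin_two]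
  simp only [map_sub, map_mul, map_add]
  rw [moebius, div_eq_iff d1] at h
  rw [moebius, div_eq_iff d2] at e1
  rw [moebius, div_eq_iff d3] at e2
  set y := frob F L α
  set z := frob F L y
  set w := frob F L z
  set V := Polynomial.aeval α (quadraticPoly F)
  set V' := frob F L V
  refine mul_left_cancel₀ (mul_ne_zero hU hUy) ?_
  -- Together with `hQ`, this identifies the value with (z - α)(w - y)/((y - α)(w - z)).
  have t : (y - α) * (z - y) * (V * V') = (z - α) * (w - y) := by
    linear_combination (z - y) * V' * hV + (z - α) * hV1
  have key : (z - α) * (w - y) * (algebraMap F L (A 0 0) * algebraMap F L (A 1 1) -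
      algebraMap F L (A 0 1) * algebraMap F L (A 1 0)) =
      (algebraMap F L (A 0 0) + algebraMap F L (A 1 1)) ^ 2 * (y - α) * (w - z) := by
    refine sub_mul_sub_mul_det_eq ?_ h e1 e2
    simpa only [map_sub, map_mul, map_ne_zero] using
      (map_ne_zero (algebraMap F L)).2 (det_entries_ne_zero A)
  linear_combination (algebraMap F L (A 0 0) * algebraMap F L (A 1 1) -
      algebraMap F L (A 0 1) * algebraMap F L (A 1 0)) * t + key -
      (algebraMap F L (A 0 0) + algebraMap F L (A 1 1)) ^ 2 * (y - α) * hQ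

/-- If the standard invariant function takes a value in `F` at a generic point `α`, then `α ^ q` is
in the orbit of `α`. -/
theorem exists_moebius_eq_frob {α : L} (hα : frob F L (frob F L α) ≠ α) {t : F}
    (ht : Polynomial.aeval α (invNum F) = algebraMap F L t * Polynomial.aeval α (invDenom F)) :
    ∃ A : GL (Fin 2) F, moebius A α = frob F L α := by
  have hg := isGeneric_of_frob_frob_ne hα
  have hlt := natDegree_invDenom_lt F
  have hlt' : (Polynomial.C t * invDenom F).natDegree < (invNum F).natDegree := by
    rw [natDegree_invNum]
    exact (Polynomial.natDegree_C_mul_le _ _).trans_lt hlt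
  have hm : (invNum F - Polynomial.C t * invDenom F).Monic :=
    (monic_invNum F).sub_of_left (Polynomial.degree_lt_degree hlt')
  have hd : (invNum F - Polynomial.C t * invDenom F).natDegree = Nat.card PGL(2, F) := by
    rw [Polynomial.natDegree_sub_eq_left_of_natDegree_lt hlt', natDegree_invNum]
  have hev : ∀ x : L, ((invNum F - Polynomial.C t * invDenom F).map (algebraMap F L)).eval x =
      Polynomial.aeval x (invNum F) - algebraMap F L t * Polynomial.aeval x (invDenom F) := by
    intro x
    rw [Polynomial.eval_map_algebraMap, map_sub, map_mul, Polynomial.aeval_C]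
  have hQ : Polynomial.aeval α (invDenom F) ≠ 0 := fun h =>
    hg.notMem_range (aeval_invDenom_eq_zero_iff.1 h)
  have horb : ∀ A : GL (Fin 2) F,
      ((invNum F - Polynomial.C t * invDenom F).map (algebraMap F L)).eval (moebius A α) = 0 := by
    intro A
    have := aeval_moebius_invNum_mul A hg.notMem_range
    rw [hev]
    refine mul_right_cancel₀ hQ ?_
    linear_combination this + Polynomial.aeval (moebius A α) (invDenom F) * ht
  -- The polynomial has coefficients in F, so Frobenius permutes its roots.
  have hfrob : ((invNum F - Polynomial.C t * invDenom F).map (algebraMap F L)).eval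
      (frob F L α) = 0 := by
    rw [hev, Polynomial.aeval_algHom_apply, Polynomial.aeval_algHom_apply, ht, map_mul,
      AlgHom.commutes, sub_self]
  obtain ⟨A, hA⟩ := exists_moebius_of_eval_eq_zero hg (hm.map (algebraMap F L)).ne_zero
    (by rw [Polynomial.natDegree_map, hd]) horb hfrob
  exact ⟨A, hA.symm⟩

end

end PGLConj

/-! ### Every admissible generator is affine in the standard function. -/

namespace PGLConj

section

open Matrix Matrix.ProjGenLinGroup

variable {F : Type*} [Field F]

theorem linearFractional_eq_moebius (A : GL (Fin 2) F) :
    linearFractional A = moebius A (RatFunc.X : RatFunc F) := rfl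

/-- The numerator and denominator of a fraction written in any way are proportional to the reduced
ones. -/
theorem exists_eq_num_mul_denom_mul {p d : F[X]} (hd : d ≠ 0) {r : RatFunc F}
    (hr : r = algebraMap F[X] (RatFunc F) p / algebraMap F[X] (RatFunc F) d) :
    ∃ h : F[X], p = r.num * h ∧ d = r.denom * h := by
  have hmul := (RatFunc.num_mul_eq_mul_denom_iff hd).2 hr
  obtain ⟨h, hh⟩ : r.denom ∣ d := by
    rw [hr]
    exact RatFunc.denom_div_dvd p d
  refine ⟨h, ?_, hh⟩
  refine mul_right_cancel₀ r.denom_ne_zero ?_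
  rw [← hmul, hh]
  ring

/-- `RatFunc.eval` uses the reduced fraction; a common factor cancels as long as it does not vanish
at y. -/
theorem eval_eq_aeval_div_aeval {p d : F[X]} {r : RatFunc F}
    (hr : r = algebraMap F[X] (RatFunc F) p / algebraMap F[X] (RatFunc F) d) {y : RatFunc F}
    (hy : Polynomial.aeval y d ≠ 0) :
    r.eval (algebraMap F (RatFunc F)) y = Polynomial.aeval y p / Polynomial.aeval y d := by
  have hd : d ≠ 0 := by rintro rfl; simp at hy
  obtain ⟨h, h1, h2⟩ := exists_eq_num_mul_denom_mul hd hr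
  have hh : Polynomial.aeval y h ≠ 0 := by
    intro h0
    rw [h2, map_mul, h0, mul_zero] at hy
    exact hy rfl
  rw [RatFunc.eval, ← Polynomial.aeval_def, ← Polynomial.aeval_def, h1, h2, map_mul, map_mul,
    mul_div_mul_right _ _ hh]

open Classical in
theorem value_eq_of_isCoprime {L : Type*} [Field L] [Algebra F L] {p d : F[X]} (hd : d ≠ 0)
    (hpd : IsCoprime p d) {r : RatFunc F}
    (hr : r = algebraMap F[X] (RatFunc F) p / algebraMap F[X] (RatFunc F) d) (y : L) :
    value r y = if Polynomial.aeval y d = 0 then ∞ else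
      ((Polynomial.aeval y p / Polynomial.aeval y d : L) : OnePoint L) := by
  obtain ⟨h, h1, h2⟩ := exists_eq_num_mul_denom_mul hd hr
  have hu : IsUnit h := hpd.isUnit_of_dvd' ⟨r.num, by rw [h1, mul_comm]⟩ ⟨r.denom, by rw [h2, mul_comm]⟩
  have hh : Polynomial.aeval y h ≠ 0 := (hu.map (Polynomial.aeval y)).ne_zero
  rw [value, h1, h2, map_mul, map_mul, mul_div_mul_right _ _ hh]
  simp [hh]

theorem aeval_ratFuncX (p : F[X]) :
    Polynomial.aeval (RatFunc.X : RatFunc F) p = algebraMap F[X] (RatFunc F) p := by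
  rw [← RatFunc.algebraMap_X, Polynomial.aeval_algebraMap_apply, Polynomial.aeval_X_left_apply]

theorem aeval_moebius_of_mem_invariantFunctions {r : RatFunc F} (hr : r ∈ invariantFunctions F)
    {p d : F[X]} (hrd : r = algebraMap F[X] (RatFunc F) p / algebraMap F[X] (RatFunc F) d)
    (hr0 : r ≠ 0) (A : GL (Fin 2) F) :
    Polynomial.aeval (moebius A (RatFunc.X : RatFunc F)) p =
      r * Polynomial.aeval (moebius A (RatFunc.X : RatFunc F)) d := by
  have hd : d ≠ 0 := by
    rintro rfl
    simp [hrd] at hr0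
  obtain ⟨h, h1, h2⟩ := exists_eq_num_mul_denom_mul hd hrd
  have hA := hr A
  rw [compLinearFractional, RatFunc.eval, linearFractional_eq_moebius, ← Polynomial.aeval_def,
    ← Polynomial.aeval_def] at hA
  -- With division by zero giving 0, a vanishing denominator would force r = 0.
  have h0 : Polynomial.aeval (moebius A (RatFunc.X : RatFunc F)) r.denom ≠ 0 := by
    intro h0
    rw [h0, div_zero] at hA
    exact hr0 hA.symm
  rw [div_eq_iff h0] at hA
  rw [h1, h2, map_mul, map_mul, hA, mul_assoc]

theorem IsInvariantGenerator.mem {Φ : RatFunc F} (hΦ : IsInvariantGenerator Φ) :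
    Φ ∈ invariantFunctions F := by
  rw [← hΦ]
  exact IntermediateField.mem_adjoin_simple_self F Φ

variable [Finite F]

variable (F) in
/-- The standard `PGL(2, q)`-invariant rational function. -/
noncomputable def invFunction : RatFunc F :=
  algebraMap F[X] (RatFunc F) (invNum F) / algebraMap F[X] (RatFunc F) (invDenom F)

theorem aeval_moebius_X_invNum (A : GL (Fin 2) F) :
    Polynomial.aeval (moebius A (RatFunc.X : RatFunc F)) (invNum F) =
      invFunction F * Polynomial.aeval (moebius A (RatFunc.X : RatFunc F)) (invDenom F) := by
  have h := aeval_moebius_invNum_mul A (isGeneric_X (F := F)).notMem_range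
  rw [aeval_ratFuncX, aeval_ratFuncX] at h
  have h0 : algebraMap F[X] (RatFunc F) (invDenom F) ≠ 0 :=
    RatFunc.algebraMap_ne_zero (monic_invDenom F).ne_zero
  rw [invFunction, div_mul_eq_mul_div, eq_div_iff h0, h]

theorem moebius_notMem_range {L : Type*} [Field L] [Algebra F L] (A : GL (Fin 2) F) {α : L}
    (hα : α ∉ Set.range (algebraMap F L)) : moebius A α ∉ Set.range (algebraMap F L) := by
  intro h
  have hJ := bottom_ne_zero A hα
  have hJ' : algebraMap F L (A 1 0) * frob F L α + algebraMap F L (A 1 1) ≠ 0 := by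
    refine bottom_ne_zero A fun h' => hα ?_
    rw [mem_range_iff_frob] at h' ⊢
    exact (frob F L).injective h'
  have key := moebius_sub_moebius A hJ hJ'
  rw [← frob_moebius, mem_range_iff_frob.1 h, sub_self, zero_mul, eq_comm, mul_eq_zero] at key
  rcases key with h1 | h1
  · exact det_entries_ne_zero A (by simpa only [map_eq_zero] using h1)
  · exact frob_sub_ne_zero hα h1

theorem invFunction_mem_invariantFunctions : invFunction F ∈ invariantFunctions F := by
  intro A
  have h0 : Polynomial.aeval (moebius A (RatFunc.X : RatFunc F)) (invDenom F) ≠ 0 := fun h =>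
    moebius_notMem_range A (isGeneric_X (F := F)).notMem_range (aeval_invDenom_eq_zero_iff.1 h)
  rw [compLinearFractional, linearFractional_eq_moebius, eval_eq_aeval_div_aeval (r := invFunction F) rfl h0,
    aeval_moebius_X_invNum, mul_div_cancel_right₀ _ h0]

theorem invFunction_ne_algebraMap (c : F) : invFunction F ≠ algebraMap F (RatFunc F) c := by
  intro h
  have h0 : algebraMap F[X] (RatFunc F) (invDenom F) ≠ 0 :=
    RatFunc.algebraMap_ne_zero (monic_invDenom F).ne_zero
  rw [invFunction, div_eq_iff h0, RatFunc.algebraMap_eq_C, ← RatFunc.algebraMap_C, ← map_mul] at h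
  have h' := congrArg Polynomial.natDegree (RatFunc.algebraMap_injective F h)
  rw [natDegree_invNum] at h'
  have := Polynomial.natDegree_C_mul_le c (invDenom F)
  have := natDegree_invDenom_lt F
  omega

/-- Zero generates only the constants, whereas `invFunction F` is a non-constant invariant. -/
theorem IsInvariantGenerator.ne_zero {Φ : RatFunc F} (hΦ : IsInvariantGenerator Φ) : Φ ≠ 0 := by
  rintro rfl
  have h := invFunction_mem_invariantFunctions (F := F)
  rw [← hΦ, IntermediateField.adjoin_zero] at h
  obtain ⟨c, hc⟩ := IntermediateField.mem_bot.1 h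
  exact invFunction_ne_algebraMap c hc.symm

/-- A non-zero invariant function of the form `f / g` with `deg g < deg f = |PGL(2, q)|` is an
affine function of the standard one. -/
theorem exists_eq_affine_invFunction {Φ : RatFunc F} (hΦ : Φ ∈ invariantFunctions F) (hΦ0 : Φ ≠ 0)
    {f g : F[X]} (hfg : Φ = algebraMap F[X] (RatFunc F) f / algebraMap F[X] (RatFunc F) g)
    (hf : f.natDegree = Nat.card PGL(2, F)) (hg : g.natDegree < Nat.card PGL(2, F)) :
    ∃ a b : F, b ≠ 0 ∧ Φ = RatFunc.C a + RatFunc.C b * invFunction F := by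
  have hg0 : g ≠ 0 := by
    rintro rfl
    simp [hfg] at hΦ0
  have hf0 : f ≠ 0 := by
    rintro rfl
    simp [hfg] at hΦ0
  set ι := algebraMap F (RatFunc F)
  set l := f.leadingCoeff with hl
  have hl0 : l ≠ 0 := Polynomial.leadingCoeff_ne_zero.2 hf0
  -- By invariance f - Φ g and `invNum` - r `invDenom`, with r = `invFunction F`, vanish at all
  -- Möbius images of X. In this combination the leading terms cancel, so its degree is below the
  -- number |G| of these images and it is zero.
  set p : (RatFunc F)[X] := (f - Polynomial.C l * invNum F).map ι - Polynomial.C Φ * g.map ι +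
    Polynomial.C (ι l * invFunction F) * (invDenom F).map ι with hp
  have hpos : 0 < Nat.card PGL(2, F) := Nat.card_pos
  have hdeg1 : (f - Polynomial.C l * invNum F).natDegree < Nat.card PGL(2, F) := by
    have hl1 : (Polynomial.C l * invNum F).natDegree = Nat.card PGL(2, F) := by
      rw [Polynomial.natDegree_C_mul hl0, natDegree_invNum]
    refine lt_of_le_of_ne ((Polynomial.natDegree_sub_le _ _).trans (by rw [hf, hl1, max_self])) ?_
    intro h
    have hc : (f - Polynomial.C l * invNum F).coeff (Nat.card PGL(2, F)) = 0 := by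
      have h1 : (invNum F).coeff (Nat.card PGL(2, F)) = 1 := by
        rw [← natDegree_invNum]
        exact monic_invNum F
      rw [Polynomial.coeff_sub, Polynomial.coeff_C_mul, h1, mul_one, hl, Polynomial.leadingCoeff, hf,
        sub_self]
    rw [← h] at hc
    have h0 : f - Polynomial.C l * invNum F = 0 := Polynomial.leadingCoeff_eq_zero.1 hc
    rw [h0, Polynomial.natDegree_zero] at h
    omega
  have hpdeg : p.natDegree < Nat.card PGL(2, F) := by
    refine (Polynomial.natDegree_add_le _ _).trans_lt (max_lt
      ((Polynomial.natDegree_sub_le _ _).trans_lt (max_lt ?_ ?_)) ?_)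
    · rwa [Polynomial.natDegree_map]
    · refine (Polynomial.natDegree_C_mul_le _ _).trans_lt ?_
      rwa [Polynomial.natDegree_map]
    · refine (Polynomial.natDegree_C_mul_le _ _).trans_lt ?_
      rw [Polynomial.natDegree_map]
      exact natDegree_invDenom_lt F
  have hp0 : p = 0 := by
    refine eq_zero_of_eval_moebius (isGeneric_X (F := F)) hpdeg fun A => ?_
    have h1 := aeval_moebius_of_mem_invariantFunctions hΦ hfg hΦ0 A
    have h2 := aeval_moebius_X_invNum A
    rw [hp, Polynomial.eval_add, Polynomial.eval_sub, Polynomial.eval_mul, Polynomial.eval_mul,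
      Polynomial.eval_C, Polynomial.eval_C, Polynomial.eval_map_algebraMap,
      Polynomial.eval_map_algebraMap, Polynomial.eval_map_algebraMap, map_sub, map_mul,
      Polynomial.aeval_C, h1, h2]
    ring
  -- At this coefficient Φ is multiplied by the non-zero leading coefficient of g, so the equation
  -- can be solved for Φ.
  have hc := congrArg (fun u => Polynomial.coeff u g.natDegree) hp0
  simp only [hp, Polynomial.coeff_add, Polynomial.coeff_sub, Polynomial.coeff_C_mul,
    Polynomial.coeff_map, Polynomial.coeff_zero, Polynomial.coeff_natDegree] at hc
  have hm0 : g.leadingCoeff ≠ 0 := Polynomial.leadingCoeff_ne_zero.2 hg0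
  have hm0' : ι g.leadingCoeff ≠ 0 := by simpa using hm0
  obtain ⟨a, b, hab⟩ : ∃ a b : F, Φ = RatFunc.C a + RatFunc.C b * invFunction F := by
    refine ⟨(f.coeff g.natDegree - l * (invNum F).coeff g.natDegree) / g.leadingCoeff,
      l * (invDenom F).coeff g.natDegree / g.leadingCoeff, ?_⟩
    rw [← RatFunc.algebraMap_eq_C]
    change Φ = ι _ + ι _ * _
    simp only [map_div₀, map_sub, map_mul] at hc ⊢
    field_simp
    linear_combination -hc
  refine ⟨a, b, ?_, hab⟩
  -- If b = 0, then Φ is constant and f = a g, contrary to the degrees.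
  rintro rfl
  rw [map_zero, zero_mul, add_zero, hfg, div_eq_iff (RatFunc.algebraMap_ne_zero hg0),
    ← RatFunc.algebraMap_C, ← map_mul] at hab
  have h' := congrArg Polynomial.natDegree (RatFunc.algebraMap_injective F hab)
  rw [hf] at h'
  have := Polynomial.natDegree_C_mul_le a g
  omega

open Classical in
theorem value_affine_invFunction {L : Type*} [Field L] [Algebra F L] (a b : F) (hb : b ≠ 0)
    (α : L) : value (RatFunc.C a + RatFunc.C b * invFunction F) α =
      if α ∈ Set.range (algebraMap F L) then ∞ else
        ((algebraMap F L a + algebraMap F L b *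
          (Polynomial.aeval α (invNum F) / Polynomial.aeval α (invDenom F)) : L) : OnePoint L) := by
  have h0 : algebraMap F[X] (RatFunc F) (invDenom F) ≠ 0 :=
    RatFunc.algebraMap_ne_zero (monic_invDenom F).ne_zero
  have hcop : IsCoprime (Polynomial.C b * invNum F + Polynomial.C a * invDenom F) (invDenom F) := by
    refine IsCoprime.add_mul_right_left ?_ _
    exact (isCoprime_mul_unit_left_left (Polynomial.isUnit_C.2 hb.isUnit) _ _).2
      (isCoprime_invNum_invDenom F)
  rw [value_eq_of_isCoprime (monic_invDenom F).ne_zero hcop]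
  · simp only [aeval_invDenom_eq_zero_iff]
    split_ifs with h
    · rfl
    · have h1 : Polynomial.aeval α (invDenom F) ≠ 0 := fun h' => h (aeval_invDenom_eq_zero_iff.1 h')
      congr 1
      simp only [map_add, map_mul, Polynomial.aeval_C]
      field_simp
      ring
  · rw [invFunction, map_add, map_mul, map_mul, RatFunc.algebraMap_C, RatFunc.algebraMap_C]
    field_simp
    ring

end

end PGLConj

/-! ### Matching points with conjugacy classes. -/

namespace PGLConj

section

open Matrix Matrix.ProjGenLinGroup

theorem ncard_ne_coe {F : Type*} [Finite F] (a : F) : {z : OnePoint F | z ≠ (a : OnePoint F)}.ncard = Nat.card F := by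
  have : Finite (OnePoint F) := inferInstanceAs (Finite (Option F))
  have h := Set.ncard_add_ncard_compl ({(a : OnePoint F)} : Set (OnePoint F))
  have hc : Nat.card (OnePoint F) = Nat.card F + 1 := Finite.card_option
  rw [Set.ncard_singleton, hc] at h
  have : ({(a : OnePoint F)} : Set (OnePoint F))ᶜ = {z | z ≠ (a : OnePoint F)} := rfl
  rw [this] at h
  omega

section Classes

variable {F : Type*} [Field F]

open Classical in
/-- The conjugacy class of the non-trivial elements `s` of `PGL(2, F)` with
`tr(s) ^ 2 / det(s) = t ≠ 0`. -/
noncomputable def traceClass (t : F) : ConjClasses PGL(2, F) :=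
  if h : t ≠ 0 then ConjClasses.mk (mk (companion t t h)) else ConjClasses.mk 1

theorem mk_eq_traceClass_iff {A : GL (Fin 2) F} (hA : mk A ≠ 1) {t : F} (ht : t ≠ 0) :
    ConjClasses.mk (mk A) = traceClass t ↔ A.1.trace ^ 2 = t * A.1.det := by
  rw [traceClass, dif_pos ht, ConjClasses.mk_eq_mk_iff_isConj,
    isConj_mk_iff hA (mk_companion_ne_one _ _ _), trace_companion, det_companion]
  constructor
  · rintro ⟨u, hu, h1, h2⟩
    refine mul_left_cancel₀ (pow_ne_zero 2 hu) ?_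
    linear_combination t * h2 - (u * A.1.trace + t) * h1
  · intro h
    have h0 : A.1.trace ≠ 0 := by
      intro h0
      rw [h0, zero_pow two_ne_zero, eq_comm] at h
      exact mul_ne_zero ht A.det_ne_zero h
    -- Matching the traces forces this scaling factor.
    refine ⟨t / A.1.trace, div_ne_zero ht h0, ?_, ?_⟩
    · field_simp
    · field_simp
      linear_combination h

theorem traceClass_notMem_involutionClasses (t : F) : traceClass t ∉ involutionClasses F := by
  by_cases ht : t = 0
  · rw [traceClass, dif_neg (not_not.2 ht), mk_mem_involutionClasses_iff, orderOf_one]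
    norm_num
  · rw [traceClass, dif_pos ht, mk_mem_involutionClasses_iff, orderOf_mk_eq_two_iff,
      trace_companion]
    exact fun h => ht h.2

theorem traceClass_ne_one {t : F} (ht : t ≠ 0) : traceClass t ≠ ConjClasses.mk 1 := by
  rw [traceClass, dif_pos ht, Ne, ConjClasses.mk_eq_mk_iff_isConj, isConj_comm, isConj_one_right]
  exact fun h => mk_companion_ne_one _ _ _ h

theorem traceClass_injOn : Set.InjOn (traceClass (F := F)) {t | t ≠ 0} := by
  intro s hs t ht h
  have h1 : traceClass s = ConjClasses.mk (mk (companion s s hs)) := dif_pos hs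
  rw [h1, mk_eq_traceClass_iff (mk_companion_ne_one _ _ _) ht, trace_companion, det_companion] at h
  exact mul_right_cancel₀ hs (by linear_combination h)

theorem exists_eq_traceClass {s : PGL(2, F)} (h1 : s ≠ 1) (h2 : orderOf s ≠ 2) :
    ∃ t : F, t ≠ 0 ∧ ConjClasses.mk s = traceClass t := by
  obtain ⟨A, rfl⟩ := mk_surjective s
  have h0 : A.1.trace ≠ 0 := fun h => h2 (orderOf_mk_eq_two_iff.2 ⟨h1, h⟩)
  have hd := A.det_ne_zero
  have ht : A.1.trace ^ 2 / A.1.det ≠ 0 := div_ne_zero (pow_ne_zero 2 h0) hd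
  exact ⟨_, ht, (mk_eq_traceClass_iff h1 ht).2 (div_mul_cancel₀ _ hd).symm⟩

/-- The bijection between the points of `ℙ¹(F)` other than `a` and the classes not consisting of
involutions, when `a + b r` (with `r` the standard invariant function) is used as coordinate. -/
noncomputable def pointClass (a b : F) (z : OnePoint F) : ConjClasses PGL(2, F) :=
  z.elim (ConjClasses.mk 1) fun c => traceClass ((c - a) / b)

theorem bijOn_pointClass (a : F) {b : F} (hb : b ≠ 0) :
    Set.BijOn (pointClass a b) {z | z ≠ (a : OnePoint F)} (involutionClasses F)ᶜ := by
  have hne : ∀ c : F, (c : OnePoint F) ≠ (a : OnePoint F) → (c - a) / b ≠ 0 := fun c hc =>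
    div_ne_zero (sub_ne_zero.2 fun h => hc (by rw [h])) hb
  refine ⟨?_, ?_, ?_⟩
  · intro z _
    cases z with
    | infty =>
      change ConjClasses.mk 1 ∉ _
      rw [mk_mem_involutionClasses_iff, orderOf_one]
      norm_num
    | coe c => exact traceClass_notMem_involutionClasses _
  · intro z hz w hw h
    cases z with
    | infty =>
      cases w with
      | infty => rfl
      | coe d => exact absurd h.symm (traceClass_ne_one (hne d hw))
    | coe c =>
      cases w with
      | infty => exact absurd h (traceClass_ne_one (hne c hz))
      | coe d =>
        have := traceClass_injOn (hne c hz) (hne d hw) h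
        rw [div_left_inj' hb, sub_left_inj] at this
        rw [this]
  · intro x hx
    obtain ⟨s, rfl⟩ := ConjClasses.mk_surjective x
    by_cases h1 : s = 1
    · exact ⟨∞, OnePoint.infty_ne_coe a, by rw [h1]; rfl⟩
    · obtain ⟨t, ht, hst⟩ := exists_eq_traceClass h1
        fun h => hx (mk_mem_involutionClasses_iff.2 h)
      refine ⟨((b * t + a : F) : OnePoint F), ?_, ?_⟩
      · intro h
        rw [OnePoint.coe_eq_coe, add_eq_right] at h
        exact mul_ne_zero hb ht h
      · rw [hst]
        change traceClass _ = _
        rw [add_sub_cancel_right, mul_div_cancel_left₀ _ hb]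

end Classes

variable {F : Type*} [Field F] [Finite F] {K : Type*} [Field K] [Algebra F K]

theorem mk_ne_one_of_moebius_eq_frob {A : GL (Fin 2) F} {α : K}
    (hα : α ∉ Set.range (algebraMap F K)) (h : moebius A α = frob F K α) : mk A ≠ 1 := by
  rw [Ne, mk_eq_one_iff]
  rintro ⟨h1, h2, h3⟩
  have hJ := bottom_ne_zero A hα
  rw [moebius, div_eq_iff hJ] at h
  rw [h1, map_zero, zero_mul, zero_add] at hJ h
  rw [h2, h3, map_zero, add_zero, mul_comm] at h
  exact hα (mem_range_iff_frob.2 (mul_right_cancel₀ hJ h).symm)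

theorem act_mk_eq_pow_card_iff (A : GL (Fin 2) F) {α : K} (hα : α ∉ Set.range (algebraMap F K)) :
    act (mk A) (α : OnePoint K) = ((α ^ Nat.card F : K) : OnePoint K) ↔
      moebius A α = frob F K α := by
  rw [act_mk_eq_coe_iff A hα, frob_apply]

/-- Since t ≠ 0, α lies outside F_{q²} and is generic. Existence comes from
`exists_moebius_eq_frob`, and uniqueness from the value being tr²/det. -/
theorem frobeniusClasses_eq_singleton {α : K} (hα : α ∉ Set.range (algebraMap F K)) {t : F}
    (ht : t ≠ 0)
    (h : Polynomial.aeval α (invNum F) = algebraMap F K t * Polynomial.aeval α (invDenom F)) :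
    frobeniusClasses F α = {traceClass t} := by
  have hQ : Polynomial.aeval α (invDenom F) ≠ 0 := fun h' => hα (aeval_invDenom_eq_zero_iff.1 h')
  have hP : Polynomial.aeval α (invNum F) ≠ 0 := by
    rw [h]
    exact mul_ne_zero (by simpa using ht) hQ
  have hα2 : frob F K (frob F K α) ≠ α := fun h' => hP (aeval_invNum_eq_zero_iff.2 ⟨h', hα⟩)
  have key : ∀ A : GL (Fin 2) F, moebius A α = frob F K α →
      ConjClasses.mk (mk A) = traceClass t := by
    intro A hA
    rw [mk_eq_traceClass_iff (mk_ne_one_of_moebius_eq_frob hα hA) ht]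
    refine (algebraMap F K).injective ?_
    have hτ := aeval_invNum_mul_det hα hA
    refine mul_right_cancel₀ hQ ?_
    rw [map_mul, map_pow]
    linear_combination -hτ + algebraMap F K A.1.det * h
  obtain ⟨A, hA⟩ := exists_moebius_eq_frob hα2 h
  refine Set.Subset.antisymm ?_ ?_
  · rintro _ ⟨s, hs, rfl⟩
    obtain ⟨B, rfl⟩ := mk_surjective s
    exact key B ((act_mk_eq_pow_card_iff B hα).1 hs)
  · rw [Set.singleton_subset_iff]
    exact ⟨mk A, (act_mk_eq_pow_card_iff A hα).2 hA, key A hA⟩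

theorem mem_quadraticElements_iff {α : K} :
    α ∈ quadraticElements F K ↔ Polynomial.aeval α (invNum F) = 0 := by
  rw [aeval_invNum_eq_zero_iff, frob_frob]
  rfl

theorem orderOf_eq_two_of_act_eq {α : K} (hα : α ∈ quadraticElements F K) {s : PGL(2, F)}
    (hs : act s (α : OnePoint K) = ((α ^ Nat.card F : K) : OnePoint K)) : orderOf s = 2 := by
  obtain ⟨A, rfl⟩ := mk_surjective s
  rw [act_mk_eq_pow_card_iff A hα.2] at hs
  have hQ : Polynomial.aeval α (invDenom F) ≠ 0 := fun h' => hα.2 (aeval_invDenom_eq_zero_iff.1 h')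
  have hτ := aeval_invNum_mul_det hα.2 hs
  rw [mem_quadraticElements_iff.1 hα, zero_mul, eq_comm] at hτ
  have h0 := (mul_eq_zero.1 hτ).resolve_right hQ
  rw [pow_eq_zero_iff two_ne_zero, map_eq_zero] at h0
  exact orderOf_mk_eq_two_iff.2 ⟨mk_ne_one_of_moebius_eq_frob hα.2 hs, h0⟩

/-- In odd characteristic, a non-degenerate binary quadratic form over a finite field represents
every element. -/
theorem exists_binary_form_eq (hF : ringChar F ≠ 2) {T N : F} (h : T ^ 2 - 4 * N ≠ 0) (δ : F) :
    ∃ a c : F, a ^ 2 - T * a * c + N * c ^ 2 = δ := by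
  have := Fintype.ofFinite F
  have h2 : (2 : F) ≠ 0 := Ring.two_ne_zero hF
  -- Completing the square turns the form into x² + e c² with e ≠ 0.
  set e : F := N - (T / 2) ^ 2 with he
  have he0 : e ≠ 0 := by
    intro h0
    refine h ?_
    rw [he] at h0
    field_simp at h0
    linear_combination -h0
  obtain ⟨x, c, hxc⟩ := FiniteField.exists_root_sum_quadratic
    (f := Polynomial.X ^ 2 - Polynomial.C δ) (g := Polynomial.C e * Polynomial.X ^ 2)
    (Polynomial.degree_X_pow_sub_C two_pos δ) (Polynomial.degree_C_mul_X_pow 2 he0)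
    (FiniteField.odd_card_of_char_ne_two hF)
  refine ⟨x + T / 2 * c, c, ?_⟩
  simp only [Polynomial.eval_sub, Polynomial.eval_mul, Polynomial.eval_pow, Polynomial.eval_X,
    Polynomial.eval_C, he] at hxc
  have hT : T = 2 * (T / 2) := by field_simp
  generalize T / 2 = r at *
  rw [hT]
  linear_combination hxc

theorem frobeniusClasses_eq_involutionClasses (hF : ringChar F ≠ 2) {α : K}
    (hα : α ∈ quadraticElements F K) : frobeniusClasses F α = involutionClasses F := by
  refine Set.Subset.antisymm (Set.image_mono fun s hs => orderOf_eq_two_of_act_eq hα hs) ?_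
  rintro _ ⟨s, hs, rfl⟩
  obtain ⟨A, rfl⟩ := mk_surjective s
  obtain ⟨hA, htr⟩ := orderOf_mk_eq_two_iff.1 hs
  have hff : frob F K (frob F K α) = α := by
    rw [frob_frob]
    exact hα.1
  obtain ⟨T, hT⟩ : α + frob F K α ∈ Set.range (algebraMap F K) := by
    rw [mem_range_iff_frob, map_add, hff, add_comm]
  obtain ⟨N, hN⟩ : α * frob F K α ∈ Set.range (algebraMap F K) := by
    rw [mem_range_iff_frob, map_mul, hff, mul_comm]
  have hdisc : T ^ 2 - 4 * N ≠ 0 := by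
    intro h
    have h' := congrArg (algebraMap F K) h
    simp only [map_sub, map_pow, map_mul, map_ofNat, map_zero, hT, hN] at h'
    have : (frob F K α - α) ^ 2 = 0 := by linear_combination h'
    exact frob_sub_ne_zero hα.2 ((pow_eq_zero_iff two_ne_zero).1 this)
  -- With T and N the trace and norm of α, the trace-zero matrices sending α to α^q have rows (a,
  -- -aT + cN) and (c, -a). Their determinant is minus the binary form, so it can be made equal to
  -- det A.
  obtain ⟨a, c, hac⟩ := exists_binary_form_eq hF hdisc (-A.1.det)
  have hdet : (!![a, -a * T + c * N; c, -a] : Matrix (Fin 2) (Fin 2) F).det = A.1.det := by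
    rw [Matrix.det_fin_two_of]
    linear_combination -hac
  let B : GL (Fin 2) F := GeneralLinearGroup.mkOfDetNeZero !![a, -a * T + c * N; c, -a]
    (hdet ▸ A.det_ne_zero)
  have hBα : moebius B α = frob F K α := by
    rw [moebius, div_eq_iff (bottom_ne_zero B hα.2)]
    change algebraMap F K a * α + algebraMap F K (-a * T + c * N) =
      frob F K α * (algebraMap F K c * α + algebraMap F K (-a))
    simp only [map_add, map_mul, map_neg, hT, hN]
    ring
  have hB := mk_ne_one_of_moebius_eq_frob hα.2 hBα
  refine ⟨mk B, (act_mk_eq_pow_card_iff B hα.2).2 hBα, ?_⟩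
  rw [ConjClasses.mk_eq_mk_iff_isConj, isConj_mk_iff hB hA]
  refine ⟨1, one_ne_zero, ?_, ?_⟩
  · rw [htr, one_mul]
    change 0 = Matrix.trace !![a, -a * T + c * N; c, -a]
    rw [Matrix.trace_fin_two_of, add_neg_cancel]
  · rw [one_pow, one_mul]
    exact hdet.symm

theorem value_affine_invFunction_eq_iff {a b : F} (hb : b ≠ 0) {α : K} {c : F} :
    value (RatFunc.C a + RatFunc.C b * invFunction F) α = ((algebraMap F K c : K) : OnePoint K) ↔
      α ∉ Set.range (algebraMap F K) ∧ Polynomial.aeval α (invNum F) =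
        algebraMap F K ((c - a) / b) * Polynomial.aeval α (invDenom F) := by
  classical
  have hbK : algebraMap F K b ≠ 0 := by simpa using hb
  rw [value_affine_invFunction a b hb]
  split_ifs with h
  · simp [h]
  · have hQ : Polynomial.aeval α (invDenom F) ≠ 0 := fun h' => h (aeval_invDenom_eq_zero_iff.1 h')
    rw [OnePoint.coe_eq_coe, and_iff_right h, map_div₀, map_sub, ← div_eq_iff hQ, eq_div_iff hbK,
      eq_sub_iff_add_eq, mul_comm, add_comm]

/-- A root of `invNum F - C t * invDenom F` cannot lie in F: the denominator vanishes there but the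
numerator does not. -/
theorem exists_aeval_invNum_eq [IsAlgClosed K] (t : F) :
    ∃ α : K, α ∉ Set.range (algebraMap F K) ∧ Polynomial.aeval α (invNum F) =
      algebraMap F K t * Polynomial.aeval α (invDenom F) := by
  have hlt : (Polynomial.C t * invDenom F).natDegree < (invNum F).natDegree := by
    rw [natDegree_invNum]
    exact (Polynomial.natDegree_C_mul_le _ _).trans_lt (natDegree_invDenom_lt F)
  have hdeg : (invNum F - Polynomial.C t * invDenom F).degree ≠ 0 := by
    intro h
    have h' := Polynomial.natDegree_sub_eq_left_of_natDegree_lt hlt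
    rw [Polynomial.natDegree_eq_zero_iff_degree_le_zero.2 h.le] at h'
    omega
  obtain ⟨α, hα⟩ := IsAlgClosed.exists_aeval_eq_zero K _ hdeg
  rw [map_sub, map_mul, Polynomial.aeval_C, sub_eq_zero] at hα
  refine ⟨α, fun h => ?_, hα⟩
  rw [aeval_invDenom_eq_zero_iff.2 h, mul_zero] at hα
  exact (aeval_invNum_eq_zero_iff.1 hα).2 h

end

end PGLConj

theorem theorem7p10 {F : Type*} [Field F] [Finite F] (q : ℕ) (hq : Nat.card F = q) (hodd : Odd q)
    {K : Type*} [Field K] [Algebra F K] [IsAlgClosure F K]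
    (Φ : RatFunc F) (hΦ : PGLConj.IsInvariantGenerator Φ)
    (f g : F[X]) (hfg : Φ = algebraMap F[X] (RatFunc F) f / algebraMap F[X] (RatFunc F) g)
    (hf : f.natDegree = Nat.card PGL(2, F)) (hg : g.natDegree < Nat.card PGL(2, F)) :
    ∃ (μ : F) (C : OnePoint F → ConjClasses PGL(2, F)),
      -- every point `lam` of `F` is a value of `Φ`
      (∀ lam : F, ∃ α : K, PGLConj.value Φ α = ((algebraMap F K lam : K) : OnePoint K)) ∧
      -- `μ` is the value of `Φ` taken exactly on `F_{q²} ∖ F_q`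
      (∀ α : K, PGLConj.value Φ α = ((algebraMap F K μ : K) : OnePoint K) ↔
        α ∈ PGLConj.quadraticElements F K) ∧
      -- `C` matches the `q` points other than `μ` with the `q` classes not consisting of involutions
      Set.BijOn C {z | z ≠ (μ : OnePoint F)} (PGLConj.involutionClasses F)ᶜ ∧
      {z : OnePoint F | z ≠ (μ : OnePoint F)}.ncard = q ∧
      ((PGLConj.involutionClasses F)ᶜ).ncard = q ∧
      C ∞ = ConjClasses.mk 1 ∧
      -- for `lam ≠ μ`, the class of `lam` is the only class of elements `s` with `s(α) = α ^ q`
      (∀ lam : F, lam ≠ μ → ∀ α : K,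
        PGLConj.value Φ α = ((algebraMap F K lam : K) : OnePoint K) →
        PGLConj.frobeniusClasses F α = {C (lam : OnePoint F)}) ∧
      -- on `F_{q²} ∖ F_q` such `s` are involutions, and both classes of involutions occur
      (∀ α ∈ PGLConj.quadraticElements F K,
        (∀ s : PGL(2, F),
          PGLConj.act s (α : OnePoint K) = ((α ^ q : K) : OnePoint K) → orderOf s = 2) ∧
        PGLConj.frobeniusClasses F α = PGLConj.involutionClasses F) ∧
      (PGLConj.involutionClasses F).ncard = 2 ∧
      Nat.card (ConjClasses PGL(2, F)) = q + 2 := by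
  have hF : ringChar F ≠ 2 := by
    have := Fintype.ofFinite F
    rw [Nat.card_eq_fintype_card] at hq
    intro h
    rw [← hq, Nat.odd_iff, FiniteField.even_card_of_char_two h] at hodd
    omega
  have := IsAlgClosure.isAlgClosed (R := F) (K := K)
  obtain ⟨a, b, hb, rfl⟩ :=
    PGLConj.exists_eq_affine_invFunction hΦ.mem hΦ.ne_zero hfg hf hg
  subst hq
  have hbij := PGLConj.bijOn_pointClass a hb
  have hcompl : ((PGLConj.involutionClasses F)ᶜ).ncard = Nat.card F := by
    rw [← hbij.image_eq, hbij.injOn.ncard_image, PGLConj.ncard_ne_coe]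
  have hinv := PGLConj.ncard_involutionClasses hF
  -- The exceptional value is a, because Φ = a + b r equals a exactly where r = 0.
  refine ⟨a, PGLConj.pointClass a b, fun c => ?_, fun α => ?_, hbij, PGLConj.ncard_ne_coe a, hcompl,
    rfl, fun c hc α hα => ?_, fun α hα => ⟨fun s hs => PGLConj.orderOf_eq_two_of_act_eq hα hs,
      PGLConj.frobeniusClasses_eq_involutionClasses hF hα⟩, hinv, ?_⟩
  · simp only [PGLConj.value_affine_invFunction_eq_iff hb]
    exact PGLConj.exists_aeval_invNum_eq _
  · rw [PGLConj.value_affine_invFunction_eq_iff hb, PGLConj.mem_quadraticElements_iff, sub_self,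
      zero_div, map_zero, zero_mul, and_iff_right_iff_imp]
    exact fun h => (PGLConj.aeval_invNum_eq_zero_iff.1 h).2
  · rw [PGLConj.value_affine_invFunction_eq_iff hb] at hα
    exact PGLConj.frobeniusClasses_eq_singleton hα.1 (div_ne_zero (sub_ne_zero.2 hc) hb) hα.2
  · have : Finite (ConjClasses PGL(2, F)) := Finite.of_surjective _ ConjClasses.mk_surjective
    rw [← Set.ncard_add_ncard_compl (PGLConj.involutionClasses F), hinv, hcompl, add_comm]
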